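/- Convexity Theorem. Let $\lambda$ be an infinite cardinal and $\kappa$ a cardinal with $\operatorname{cof}\lambda\le\kappa<\lambda$. Let $\operatorname{PP}_\kappa(\lambda)$ be the set of all cardinals that are the cofinality of an ultraproduct $\prod\mathfrak a/\mathcal F$, where $\mathfrak a$ is a set of at most $\kappa$ infinite regular cardinals, all smaller than $\lambda$, and $\mathcal F$ is an ultrafilter on $\mathfrak a$ such that no subset of $\mathfrak a$ bounded below $\lambda$ (that is, with an upper bound $\theta<\lambda$) belongs to $\mathcal F$. Here each cardinal is identified with the set of ordinals below it, $\prod\mathfrak a/\mathcal F$ is ordered by $[f]\le[g]$ iff $\{\mu\in\mathfrak a: f(\mu)\le g(\mu)\}\in\mathcal F$, and the cofinality of an ordered set is the least cardinality of a cofinal subset. Then: 1. every element of $\operatorname{PP}_\kappa(\lambda)$ is an infinite regular cardinal; 2. $\lambda^+$ is the least element of $\operatorname{PP}_\kappa(\lambda)$; 3. if $\mu,\nu\in\operatorname{PP}_\kappa(\lambda)$ and $\theta$ is a regular cardinal with $\mu\le\theta\le\nu$, then $\theta\in\operatorname{PP}_\kappa(\lambda)$. -/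

import Mathlib

open Cardinal

universe u

/-- The reduced product of partially ordered sets modulo a filter, partially ordered by
pointwise comparison modulo the filter: `[f] ≤ [g]` iff `{i | f i ≤ g i}` is in the filter. -/
instance reducedProductPartialOrder {I : Type*} (l : Filter I) (X : I → Type*)
    [∀ i, PartialOrder (X i)] : PartialOrder (Filter.Product l X) where
  le x y := Quotient.liftOn₂' x y (fun f g => ∀ᶠ i in l, f i ≤ g i) (by
    intro f g f' g' hf hg
    refine propext ⟨fun h => ?_, fun h => ?_⟩
    · filter_upwards [h, hf, hg] with i h1 h2 h3
      exact (h2 ▸ h3 ▸ h1)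
    · filter_upwards [h, hf, hg] with i h1 h2 h3
      rw [h2, h3]
      exact h1)
  le_refl x := by
    induction x using Quotient.inductionOn'
    exact Filter.Eventually.of_forall fun i => le_refl _
  le_trans x y z := by
    induction x using Quotient.inductionOn'
    induction y using Quotient.inductionOn'
    induction z using Quotient.inductionOn'
    intro h1 h2
    filter_upwards [h1, h2] with i h1 h2
    exact h1.trans h2
  le_antisymm x y := by
    induction x using Quotient.inductionOn'
    induction y using Quotient.inductionOn'
    intro h1 h2
    refine Quotient.sound' ?_
    filter_upwards [h1, h2] with i h1 h2
    exact le_antisymm h1 h2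

/-- The ultraproduct `∏ a / F` of a set `a` of cardinals, each cardinal `μ ∈ a` being identified
with the set of ordinals below its initial ordinal. -/
abbrev CardinalUltraproduct (a : Set Cardinal.{u}) (F : Ultrafilter a) : Type (u + 1) :=
  Filter.Product (F : Filter a) (fun μ : a => Set.Iio (μ : Cardinal.{u}).ord)

/-- A set of members of `a` is bounded below `lam` if some cardinal `θ < lam` bounds it. -/
def BoundedBelow (lam : Cardinal.{u}) {a : Set Cardinal.{u}} (b : Set a) : Prop :=
  ∃ θ < lam, ∀ μ ∈ b, (μ : Cardinal.{u}) ≤ θ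

/-- `PP κ lam` is the set of cofinalities of the ultraproducts `∏ a / F`, where `a` is a set of at
most `κ` regular cardinals below `lam` and `F` is an ultrafilter on `a` that contains no set
bounded below `lam`. The lifts only change the universe level. -/
def PP (κ lam : Cardinal.{u}) : Set Cardinal.{u} :=
  {ν | ∃ a : Set Cardinal.{u},
    (∀ μ ∈ a, μ.IsRegular ∧ μ < lam) ∧ #a ≤ Cardinal.lift.{u + 1} κ ∧
    ∃ F : Ultrafilter a,
      (∀ b : Set a, BoundedBelow lam b → b ∉ F) ∧
      Order.cof (CardinalUltraproduct a F) = Cardinal.lift.{u + 1} ν}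

-- Everything reduces to convexity above λ: if ν is the cofinality of `∏ a / F` and θ is regular
-- with λ < θ < ν, then θ is again such a cofinality. As fewer than ν functions are bounded modulo
-- `F`, there is an increasing sequence of length θ that, at each δ of cofinality below λ, bounds
-- simultaneously its terms at the limit points of a cofinal subset of δ
-- (`exists_continuous_increasing_sequence`). Club guessing then shows that the sequence is not
-- interleaved with any product of sets of size τ, for κ ≤ τ < λ (`exists_not_interleaved`).
--
-- Non-interleaving has two effects: the sequence has a least upper bound `g` modulo `F`
-- (`exists_lub_of_not_interleaved`), and `cof (g i)` exceeds each τ < λ almost everywhere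
-- (`eventually_lt_cof_of_not_interleaved`). The sequence is cofinal below `g`, so θ is the
-- cofinality of the product of the cardinals `cof (g i)`, which collapses to a product over the set
-- of these values (`mem_PP_of_lub`).
--
-- Fewer than λ functions always have a common bound modulo `F`, and cofinalities of ultraproducts
-- are regular while λ is singular; hence all members of `PP` exceed λ. Since `PP` is nonempty, the
-- convexity argument yields λ⁺.

universe v w

/-! ### Recursion, stabilization and cofinal sets of ordinals -/

/-- Dependent choice along a well order. -/
theorem exists_forall_of_forall_exists {ι : Type v} [LinearOrder ι] [WellFoundedLT ι]
    {X : Type w} (P : (j : ι) → (Set.Iio j → X) → X → Prop)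
    (h : ∀ j prev, ∃ x, P j prev x) : ∃ y : ι → X, ∀ j, P j (fun k => y k) (y j) := by
  choose N hN using h
  let y : ι → X := (wellFounded_lt (α := ι)).fix fun j prev => N j fun k => prev k k.2
  refine ⟨y, fun j => ?_⟩
  have : y j = N j fun k => y k := (wellFounded_lt (α := ι)).fix_eq _ j
  rw [this]
  exact hN _ _

/-- Each coordinate reaches its minimum at some stage; these stages are too few to be cofinal, so a
single stage lies beyond all of them. -/
theorem exists_forall_ge_eq_of_antitone {ι : Type v} [LinearOrder ι] {X : Type w}
    (h : Cardinal.lift.{v} #X < Cardinal.lift.{w} (Order.cof ι)) (p : ι → X → Ordinal.{u}) (hp : Antitone p) :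
    ∃ j, ∀ k ≥ j, p k = p j := by
  have hne : Nonempty ι := by
    rw [← Order.cof_ne_zero_iff]
    intro h0
    simp [h0] at h
  have hmin : ∀ x, ∃ j, ∀ k, p j x ≤ p k x := fun x =>
    ⟨Function.argmin (fun j => p j x), fun k => Function.argmin_le (fun j => p j x) k⟩
  choose m hm using hmin
  have hnc : ¬ IsCofinal (Set.range m) := fun hc => by
    have h1 := Order.cof_le hc
    have h2 := mk_range_le_lift (f := m)
    exact absurd (h2.trans_lt h) (not_lt.2 (lift_le.2 h1))
  obtain ⟨j, hj⟩ := not_isCofinal_iff.1 hnc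
  refine ⟨j, fun k hk => funext fun x => le_antisymm (hp hk x) ?_⟩
  exact (hp (hj _ ⟨x, rfl⟩).le x).trans (hm x k)

theorem exists_lt_ord_of_isRegular {θ : Cardinal.{u}} (hθ : θ.IsRegular) {ι : Type v}
    (h : Cardinal.lift.{u} #ι < Cardinal.lift.{v} θ) (f : ι → Ordinal.{u}) (hf : ∀ i, f i < θ.ord) :
    ∃ b < θ.ord, ∀ i, f i < b := by
  have hs : Small.{u} ι := by
    rw [← mk_out θ] at h
    obtain ⟨e⟩ := lift_mk_le'.1 h.le
    exact small_of_injective e.injective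
  refine ⟨⨆ i, f i + 1, Ordinal.lift_iSup_add_one_lt_of_lt_cof ?_ hf, fun i => ?_⟩
  · rw [← Ordinal.lift_cof, hθ.cof_ord]
    exact h
  · exact Ordinal.lt_iSup_add_one _ i

theorem exists_cofinal_subset (o : Ordinal.{u}) :
    ∃ A ⊆ Set.Iio o, (∀ z < o, ∃ x ∈ A, z ≤ x) ∧ #A = Cardinal.lift.{u + 1} o.cof := by
  obtain ⟨s, hs, hc⟩ := Order.exists_cof_eq (Set.Iio o)
  refine ⟨Subtype.val '' s, by rintro _ ⟨x, -, rfl⟩; exact x.2, fun z hz => ?_, ?_⟩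
  · obtain ⟨x, hx, hzx⟩ := hs ⟨z, hz⟩
    exact ⟨x, ⟨x, hx, rfl⟩, hzx⟩
  · rw [mk_image_eq Subtype.val_injective, hc, Ordinal.cof_Iio, Ordinal.lift_cof]

theorem lift_cof_le_of_cofinal {o : Ordinal.{u}} {A : Set Ordinal.{u}}
    (hA : A ⊆ Set.Iio o) (h : ∀ z < o, ∃ x ∈ A, z ≤ x) : Cardinal.lift.{u + 1} o.cof ≤ #A := by
  rw [Ordinal.lift_cof, ← Ordinal.cof_Iio]
  have hc : IsCofinal {x : Set.Iio o | (x : Ordinal) ∈ A} := fun z => by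
    obtain ⟨x, hx, hzx⟩ := h z z.2
    exact ⟨⟨x, hA hx⟩, hx, hzx⟩
  refine (Order.cof_le hc).trans ?_
  exact mk_le_of_injective (f := fun x => (⟨x.1.1, x.2⟩ : A))
    (fun x y hxy => Subtype.ext (Subtype.ext (by simpa using hxy)))

theorem mk_Iio_lt_lift {c : Cardinal.{u}} {j : Ordinal.{u}} (hj : j < c.ord) :
    #(Set.Iio j) < Cardinal.lift.{u + 1} c := by
  rw [mk_Iio_ordinal, lift_lt]
  exact lt_ord.1 hj

theorem mk_Iio_coe_lt_lift {o : Ordinal.{u}} (j : Set.Iio o) {c : Cardinal.{u}}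
    (hj : j < c.ord) : #(Set.Iio j) < Cardinal.lift.{u + 1} c :=
  (mk_le_of_injective (f := fun k : Set.Iio j => (⟨k.1.1, k.2⟩ : Set.Iio j.1))
    fun x y hxy => Subtype.ext (Subtype.ext (by simpa [Subtype.ext_iff] using hxy))).trans_lt (mk_Iio_lt_lift hj)

/-! ### Club guessing -/

/-- The ordinals closed under `φ`. -/
def closurePoints (φ : Ordinal.{u} → Ordinal.{u}) : Set Ordinal.{u} :=
  {j | ∀ k < j, φ k < j}

theorem closurePoints_anti {φ ψ : Ordinal.{u} → Ordinal.{u}} {j : Ordinal.{u}}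
    (h : ∀ k < j, φ k ≤ ψ k) (hj : j ∈ closurePoints ψ) : j ∈ closurePoints φ :=
  fun k hk => (h k hk).trans_lt (hj k hk)

/-- The largest ordinal up to `b` that is closed under `φ`. -/
noncomputable def lastClosurePoint (φ : Ordinal.{u} → Ordinal.{u}) (b : Ordinal.{u}) :
    Ordinal.{u} :=
  sSup {x | x ≤ b ∧ x ∈ closurePoints φ}

theorem bddAbove_closurePoints_le (φ : Ordinal.{u} → Ordinal.{u}) (b : Ordinal.{u}) :
    BddAbove {x | x ≤ b ∧ x ∈ closurePoints φ} := ⟨b, fun _ hx => hx.1⟩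

theorem zero_mem_closurePoints (φ : Ordinal.{u} → Ordinal.{u}) : 0 ∈ closurePoints φ :=
  fun _ hk => absurd hk (not_lt.2 (zero_le))

theorem lastClosurePoint_le (φ : Ordinal.{u} → Ordinal.{u}) (b : Ordinal.{u}) :
    lastClosurePoint φ b ≤ b :=
  csSup_le ⟨0, zero_le, zero_mem_closurePoints φ⟩ fun _ hx => hx.1

theorem le_lastClosurePoint {φ : Ordinal.{u} → Ordinal.{u}} {b x : Ordinal.{u}} (hx : x ≤ b)
    (h : x ∈ closurePoints φ) : x ≤ lastClosurePoint φ b :=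
  le_csSup (bddAbove_closurePoints_le φ b) ⟨hx, h⟩

theorem lastClosurePoint_mem (φ : Ordinal.{u} → Ordinal.{u}) (b : Ordinal.{u}) :
    lastClosurePoint φ b ∈ closurePoints φ := by
  intro k hk
  obtain ⟨x, hx, hkx⟩ := exists_lt_of_lt_csSup
    (s := {x | x ≤ b ∧ x ∈ closurePoints φ}) ⟨0, zero_le, zero_mem_closurePoints φ⟩ hk
  exact (hx.2 k hkx).trans_le (le_lastClosurePoint hx.1 hx.2)

theorem lastClosurePoint_anti {φ ψ : Ordinal.{u} → Ordinal.{u}} {b : Ordinal.{u}}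
    (h : ∀ k < b, φ k ≤ ψ k) : lastClosurePoint ψ b ≤ lastClosurePoint φ b :=
  csSup_le ⟨0, zero_le, zero_mem_closurePoints ψ⟩ fun _ hx =>
    le_lastClosurePoint hx.1 (closurePoints_anti (fun k hk => h k (hk.trans_le hx.1)) hx.2)

theorem exists_closurePoint_gt {μ : Cardinal.{u}} (hμ : μ.IsRegular) (hμ' : μ ≠ ℵ₀)
    {φ : Ordinal.{u} → Ordinal.{u}} (hφ : ∀ k < μ.ord, φ k < μ.ord) {z : Ordinal.{u}}
    (hz : z < μ.ord) : ∃ x ∈ closurePoints φ, z < x ∧ x < μ.ord := by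
  let g : Ordinal.{u} → Ordinal.{u} := fun b => ⨆ k : Set.Iio b, φ k + 1
  have hz1 : z + 1 < μ.ord := (isSuccLimit_ord hμ.aleph0_le).add_one_lt hz
  refine ⟨Ordinal.nfp g (z + 1), fun k hk => ?_, ?_, ?_⟩
  · obtain ⟨n, hn⟩ := Ordinal.lt_nfp_iff.1 hk
    refine Ordinal.lt_nfp_iff.2 ⟨n + 1, ?_⟩
    rw [Function.iterate_succ_apply']
    exact Ordinal.lt_iSup_add_one (fun k : Set.Iio (g^[n] (z + 1)) => φ k) ⟨k, hn⟩
  · exact (lt_add_one z).trans_le (Ordinal.le_nfp _ _)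
  · refine nfp_lt_ord_of_isRegular hμ hμ' (fun b hb => ?_) hz1
    refine Ordinal.lift_iSup_add_one_lt_of_lt_cof ?_ fun k => hφ k (k.2.trans hb)
    rw [← Ordinal.lift_cof, hμ.cof_ord, lift_id'.{u, u + 1}]
    exact mk_Iio_lt_lift hb

/-- Limits of closure points of any prescribed smaller cofinality exist. -/
theorem exists_cof_eq_limit_closurePoints {σ μ : Cardinal.{u}} (hσ : σ.IsRegular)
    (hμ : μ.IsRegular) (hσμ : σ < μ)
    {φ : Ordinal.{u} → Ordinal.{u}} (hφ : ∀ k < μ.ord, φ k < μ.ord) :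
    ∃ b < μ.ord, b.cof = σ ∧ ∀ z < b, ∃ x ∈ closurePoints φ, z < x ∧ x < b := by
  obtain ⟨y, hy⟩ := exists_forall_of_forall_exists (ι := Set.Iio σ.ord) (X := Set.Iio μ.ord)
    (fun j prev x => (x : Ordinal) ∈ closurePoints φ ∧ ∀ k, prev k < x) (by
      intro j prev
      obtain ⟨b, hb, hbp⟩ := exists_lt_ord_of_isRegular hμ (ι := Set.Iio j) (by
        rw [lift_id'.{u, u + 1}]
        exact mk_Iio_coe_lt_lift j (lt_trans j.2 (ord_lt_ord.2 hσμ)))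
        (fun k => (prev k : Ordinal)) (fun k => (prev k).2)
      obtain ⟨x, hx, hbx, hxμ⟩ := exists_closurePoint_gt hμ (hσ.aleph0_le.trans_lt hσμ).ne' hφ hb
      exact ⟨⟨x, hxμ⟩, hx, fun k => (hbp k).trans hbx⟩)
  have hmono : StrictMono fun j => (y j : Ordinal) := fun j k hjk => (hy k).2 ⟨j, hjk⟩
  have hlim := isSuccLimit_ord hσ.aleph0_le
  have hlt : ∀ j, (y j : Ordinal) < ⨆ j, (y j : Ordinal) := fun j => by
    have : (⟨j.1 + 1, hlim.add_one_lt j.2⟩ : Set.Iio σ.ord) > j := lt_add_one j.1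
    exact (hmono this).trans_le (Ordinal.le_iSup (fun j => (y j : Ordinal)) _)
  refine ⟨⨆ j, (y j : Ordinal), ?_, ?_, fun z hz => ?_⟩
  · refine Ordinal.lift_iSup_lt_of_lt_cof ?_ fun k => (y k).2
    rw [← Ordinal.lift_cof, hμ.cof_ord, lift_id'.{u, u + 1}, mk_Iio_ordinal, card_ord, lift_lt]
    exact hσμ
  · rw [Ordinal.cof_iSup_Iio hmono hlim.isSuccPrelimit, hσ.cof_ord]
  · obtain ⟨j, hj⟩ := Ordinal.lt_iSup_iff.1 hz
    exact ⟨y j, (hy j).1, hj, hlt j⟩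

/-- Club guessing, for closure points of functions. -/
theorem exists_club_guessing {σ μ : Cardinal.{u}} (hσ : σ.IsRegular) (hμ : μ.IsRegular)
    (hσμ : Order.succ σ < μ) :
    ∃ C : Ordinal.{u} → Set Ordinal.{u}, (∀ b, C b ⊆ Set.Iio b) ∧
      ∀ φ : Ordinal.{u} → Ordinal.{u}, (∀ k < μ.ord, φ k < μ.ord) →
        ∃ b < μ.ord, Cardinal.lift.{u + 1} σ ≤ #(C b) ∧ C b ⊆ closurePoints φ \ {0} := by
  choose A hAsub hAcof hAcard using exists_cofinal_subset.{u}
  have hσμ' : σ < μ := (Order.lt_succ σ).trans hσμ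
  -- The guess at `b` is a fixed cofinal set `A b` with each point pushed down to the last closure
  -- point of one well-chosen `φ`; it stays cofinal when `b` is a limit of closure points of `φ`.
  suffices h : ∃ φ : Ordinal.{u} → Ordinal.{u}, (∀ k < μ.ord, φ k < μ.ord) ∧
      ∀ ψ : Ordinal.{u} → Ordinal.{u}, (∀ k < μ.ord, ψ k < μ.ord) →
        ∃ b < μ.ord, b.cof = σ ∧ (∀ z < b, ∃ x ∈ closurePoints φ, z < x ∧ x < b) ∧
          ∀ x ∈ A b, lastClosurePoint φ x ≠ 0 → lastClosurePoint φ x ∈ closurePoints ψ by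
    obtain ⟨φ, -, hφ⟩ := h
    refine ⟨fun b => lastClosurePoint φ '' A b \ {0}, fun b => ?_, fun ψ hψ => ?_⟩
    · rintro _ ⟨⟨x, hx, rfl⟩, -⟩
      exact (lastClosurePoint_le φ x).trans_lt (hAsub b hx)
    · obtain ⟨b, hb, hbσ, hlim, hbψ⟩ := hφ ψ hψ
      refine ⟨b, hb, ?_, ?_⟩
      · rw [← hbσ]
        refine lift_cof_le_of_cofinal ?_ fun z hz => ?_
        · rintro _ ⟨⟨x, hx, rfl⟩, -⟩
          exact (lastClosurePoint_le φ x).trans_lt (hAsub b hx)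
        · obtain ⟨x, hx, hzx, hxb⟩ := hlim z hz
          obtain ⟨a, ha, hxa⟩ := hAcof b x hxb
          have := hzx.trans_le (le_lastClosurePoint hxa hx)
          exact ⟨_, ⟨⟨a, ha, rfl⟩, (pos_of_gt this).ne'⟩, this.le⟩
      · rintro _ ⟨⟨x, hx, rfl⟩, h0⟩
        exact ⟨hbψ x hx h0, h0⟩
  -- Otherwise every `φ` is refuted by some `N φ`. Iterate this σ⁺ times, taking suprema of earlier
  -- stages. At a suitable `b` the σ pushed-down points decrease with the stage and so stabilize,
  -- but a stable point is closed under the next `N`.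
  by_contra! hcon
  choose! N hNμ hN using hcon
  have hsmall : ∀ {ι : Type (u + 1)} (x : ι → Ordinal.{u} → Ordinal.{u}),
      #ι < Cardinal.lift.{u + 1} μ → (∀ i, ∀ k < μ.ord, x i k < μ.ord) →
      ∀ k < μ.ord, ⨆ i, x i k < μ.ord := by
    intro ι x hι hx k hk
    refine Ordinal.lift_iSup_lt_of_lt_cof ?_ fun i => hx i k hk
    rwa [← Ordinal.lift_cof, hμ.cof_ord, lift_id'.{u, u + 1}]
  have hι : #(Set.Iio (Order.succ σ).ord) < Cardinal.lift.{u + 1} μ :=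
    mk_Iio_lt_lift (ord_lt_ord.2 hσμ)
  obtain ⟨y, hy⟩ := exists_forall_of_forall_exists (ι := Set.Iio (Order.succ σ).ord)
    (X := {φ : Ordinal.{u} → Ordinal.{u} // ∀ k < μ.ord, φ k < μ.ord})
    (fun j prev x => x.1 = N fun b => ⨆ k, (prev k).1 b) (by
      intro j prev
      refine ⟨⟨N fun b => ⨆ k, (prev k).1 b, hNμ _ ?_⟩, rfl⟩
      exact hsmall (fun k => (prev k).1)
        (mk_Iio_coe_lt_lift j (lt_trans j.2 (ord_lt_ord.2 hσμ))) fun k => (prev k).2)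
  set Φ : Set.Iio (Order.succ σ).ord → Ordinal.{u} → Ordinal.{u} :=
    fun j b => ⨆ k : Set.Iio j, (y k).1 b with hΦ
  have hΦμ : ∀ j, ∀ k < μ.ord, Φ j k < μ.ord := fun j =>
    hsmall (fun k : Set.Iio j => (y k).1)
      (mk_Iio_coe_lt_lift j (lt_trans j.2 (ord_lt_ord.2 hσμ))) fun k => (y k).2
  have hyΦ : ∀ {j k}, j < k → ∀ b, (y j).1 b ≤ Φ k b := fun {j k} hjk b =>
    Ordinal.le_iSup (fun i : Set.Iio k => (y i).1 b) ⟨j, hjk⟩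
  have hΦmono : ∀ {j k}, j ≤ k → ∀ b, Φ j b ≤ Φ k b := fun {j k} hjk b =>
    Ordinal.iSup_le fun i => hyΦ (lt_of_lt_of_le i.2 hjk) b
  have hΦle : ∀ j b, Φ j b ≤ ⨆ i, Φ i b := fun j b => Ordinal.le_iSup (fun i => Φ i b) j
  obtain ⟨b, hb, hbσ, hlim⟩ := exists_cof_eq_limit_closurePoints hσ hμ hσμ'
    (hsmall Φ hι hΦμ)
  have hsucc := isRegular_succ hσ.aleph0_le
  obtain ⟨j, hj⟩ := exists_forall_ge_eq_of_antitone (ι := Set.Iio (Order.succ σ).ord) (X := A b)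
    (by
      rw [hAcard, hbσ, Ordinal.cof_Iio, ← Ordinal.lift_cof, hsucc.cof_ord, lift_lift, lift_lift,
        lift_lt]
      exact Order.lt_succ σ)
    (fun j x => lastClosurePoint (Φ j) x)
    (fun j k hjk x => lastClosurePoint_anti fun b _ => hΦmono hjk b)
  have hlimsucc := isSuccLimit_ord hsucc.aleph0_le
  let j' : Set.Iio (Order.succ σ).ord := ⟨j.1 + 1, hlimsucc.add_one_lt j.2⟩
  have hjj' : j < j' := lt_add_one j.1
  obtain ⟨x, hx, h0, hxN⟩ := hN (Φ j) (hΦμ j) b hb hbσ fun z hz => by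
    obtain ⟨x, hx, h⟩ := hlim z hz
    exact ⟨x, closurePoints_anti (fun k _ => hΦle j k) hx, h⟩
  apply hxN
  have h1 : lastClosurePoint (Φ j') x = lastClosurePoint (Φ j) x :=
    congrFun (hj j' hjj'.le) ⟨x, hx⟩
  rw [← hy j, ← h1]
  exact closurePoints_anti (fun k _ => hyΦ hjj' k) (lastClosurePoint_mem _ _)

/-! ### Increasing sequences modulo a filter and their least upper bounds -/

/-- The points of `δ` that are limits of members of `A`. -/
def limitPoints (A : Set Ordinal.{u}) (δ : Ordinal.{u}) : Set Ordinal.{u} :=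
  {x | x < δ ∧ ∀ z < x, ∃ a ∈ A, z < a ∧ a < x}

/-- A sequence of functions of length `θ`, increasing modulo `F`, that dominates its suprema
over clubs at limit points of small cofinality is not cofinally interleaved with a product
of small sets. -/
theorem exists_not_interleaved {I : Type (u + 1)} (F : Filter I) [F.NeBot] {τ θ : Cardinal.{u}}
    (hτ : ℵ₀ ≤ τ) (hI : #I ≤ Cardinal.lift.{u + 1} τ) (hθ : θ.IsRegular)
    (hτθ : Order.succ (Order.succ (Order.succ τ)) < θ) (f : Ordinal.{u} → I → Ordinal.{u})
    (hinc : ∀ ξ η, ξ < η → η < θ.ord → ∀ᶠ i in F, f ξ i < f η i)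
    (hdom : ∀ δ < θ.ord, δ.cof ≤ Order.succ (Order.succ (Order.succ τ)) →
      ∃ A, (∀ z < δ, ∃ a ∈ A, z ≤ a ∧ a < δ) ∧
        ∃ η < θ.ord, ∀ᶠ i in F, ∀ x ∈ limitPoints A δ, f x i ≤ f η i)
    (S : I → Set Ordinal.{u}) (hS : ∀ i, #(S i) ≤ Cardinal.lift.{u + 1} τ) :
    ∃ ξ < θ.ord, ∀ η < θ.ord, ∀ p : I → Ordinal.{u},
      ¬ ∀ᶠ i in F, p i ∈ S i ∧ f ξ i ≤ p i ∧ p i < f η i := by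
  by_contra! hcon
  choose! nx hnx p hp using hcon
  set σ := Order.succ τ with hσdef
  set μ := Order.succ (Order.succ σ) with hμdef
  have hσ : σ.IsRegular := isRegular_succ hτ
  have hμ : μ.IsRegular := isRegular_succ (hσ.aleph0_le.trans (Order.le_succ σ))
  have hσμ : Order.succ σ < μ := Order.lt_succ _
  obtain ⟨C, hCsub, hC⟩ := exists_club_guessing hσ hμ hσμ
  have hθ0 : 0 < θ.ord := hθ.ord_pos
  -- The right guess `C b` is known only once `y` is complete, so each term makes room for a witness
  -- for every `b < μ` at once; this is possible as μ < θ.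
  obtain ⟨y, hy⟩ := exists_forall_of_forall_exists (ι := Set.Iio μ.ord) (X := Set.Iio θ.ord)
    (fun j prev x => (∀ k, prev k < x) ∧ ∀ b < μ.ord,
      (∃ η < θ.ord, ∀ᶠ i in F, ∀ k ∈ C b, k ≤ j →
        f (sSup {o | ∃ l, l.1.1 < k ∧ (prev l : Ordinal) = o}) i ≤ f η i) →
      ∃ q : I → Ordinal.{u}, ∀ᶠ i in F, q i ∈ S i ∧ (∀ k ∈ C b, k ≤ j →
        f (sSup {o | ∃ l, l.1.1 < k ∧ (prev l : Ordinal) = o}) i ≤ q i) ∧ q i < f x i) (by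
      intro j prev
      obtain ⟨b₁, hb₁, hprev⟩ := exists_lt_ord_of_isRegular hθ (ι := Set.Iio j) (by
        rw [lift_id'.{u, u + 1}]
        exact mk_Iio_coe_lt_lift j (lt_trans j.2 (ord_lt_ord.2 hτθ)))
        (fun k => (prev k : Ordinal)) (fun k => (prev k).2)
      have hex : ∀ b : Set.Iio μ.ord, ∃ e < θ.ord, (∃ η < θ.ord, ∀ᶠ i in F, ∀ k ∈ C b, k ≤ j →
          f (sSup {o | ∃ l, l.1.1 < k ∧ (prev l : Ordinal) = o}) i ≤ f η i) →
          ∃ q : I → Ordinal.{u}, ∀ᶠ i in F, q i ∈ S i ∧ (∀ k ∈ C b, k ≤ j →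
            f (sSup {o | ∃ l, l.1.1 < k ∧ (prev l : Ordinal) = o}) i ≤ q i) ∧ q i < f e i := by
        intro b
        by_cases h : ∃ η < θ.ord, ∀ᶠ i in F, ∀ k ∈ C b, k ≤ j →
          f (sSup {o | ∃ l, l.1.1 < k ∧ (prev l : Ordinal) = o}) i ≤ f η i
        · obtain ⟨η, hη, h⟩ := h
          refine ⟨nx η, hnx η hη, fun _ => ⟨p η, ?_⟩⟩
          filter_upwards [h, hp η hη] with i h1 h2
          exact ⟨h2.1, fun k hk hkj => (h1 k hk hkj).trans h2.2.1, h2.2.2⟩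
        · exact ⟨0, hθ0, fun h' => absurd h' h⟩
      choose e heθ he using hex
      obtain ⟨b₂, hb₂, heb⟩ := exists_lt_ord_of_isRegular hθ (ι := Set.Iio μ.ord) (by
        rw [lift_id'.{u, u + 1}]
        exact mk_Iio_lt_lift (ord_lt_ord.2 hτθ)) e heθ
      refine ⟨⟨max b₁ b₂, max_lt hb₁ hb₂⟩, fun k => (hprev k).trans_le (le_max_left _ _),
        fun b hb h => ?_⟩
      obtain ⟨q, hq⟩ := he ⟨b, hb⟩ h
      refine ⟨q, ?_⟩
      filter_upwards [hq, hinc (e ⟨b, hb⟩) (max b₁ b₂) ((heb _).trans_le (le_max_right _ _))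
        (max_lt hb₁ hb₂)] with i h1 h2
      exact ⟨h1.1, h1.2.1, h1.2.2.trans h2⟩)
  have hmono : ∀ {j k}, j < k → (y j : Ordinal) < y k := fun {j k} hjk => (hy k).1 ⟨j, hjk⟩
  have hmono' : ∀ {j k}, (y j : Ordinal) < y k → j < k := fun {j k} h =>
    lt_of_not_ge fun hkj => h.not_ge (hkj.eq_or_lt.elim (fun e => e ▸ le_rfl) fun e => (hmono e).le)
  set X : Ordinal.{u} → Ordinal.{u} := fun k => sSup {o | ∃ l, l.1 < k ∧ (y l : Ordinal) = o}
    with hX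
  have hXeq : ∀ (j : Set.Iio μ.ord) (k : Ordinal), k ≤ j →
      sSup {o | ∃ l : Set.Iio j, l.1.1 < k ∧ (y l : Ordinal) = o} = X k := fun j k hk => by
    congr 1
    ext o
    constructor
    · rintro ⟨l, hl, rfl⟩
      exact ⟨l, hl, rfl⟩
    · rintro ⟨l, hl, rfl⟩
      exact ⟨⟨l, hl.trans_le hk⟩, hl, rfl⟩
  have hbdd : ∀ k, BddAbove {o | ∃ l, l.1 < k ∧ (y l : Ordinal) = o} := fun k =>
    ⟨θ.ord, by rintro _ ⟨l, -, rfl⟩; exact (y l).2.le⟩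
  have hyX : ∀ {l : Set.Iio μ.ord} {k}, l.1 < k → (y l : Ordinal) ≤ X k := fun {l k} h =>
    le_csSup (hbdd k) ⟨l, h, rfl⟩
  have hXy : ∀ j, X j.1 ≤ y j := fun j => csSup_le' (by
    rintro _ ⟨l, hl, rfl⟩
    exact (hmono hl).le)
  have hlim := isSuccLimit_ord hμ.aleph0_le
  let sc : Set.Iio μ.ord → Set.Iio μ.ord := fun j => ⟨j.1 + 1, hlim.add_one_lt j.2⟩
  have hsc : ∀ j, j < sc j := fun j => lt_add_one j.1
  have hδθ : ⨆ j, (y j : Ordinal) < θ.ord := by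
    refine Ordinal.lift_iSup_lt_of_lt_cof ?_ fun k => (y k).2
    rw [← Ordinal.lift_cof, hθ.cof_ord, lift_id'.{u, u + 1}]
    exact mk_Iio_lt_lift (ord_lt_ord.2 hτθ)
  set δ := ⨆ j, (y j : Ordinal) with hδ
  have hyδ : ∀ j, (y j : Ordinal) < δ := fun j =>
    (hmono (hsc j)).trans_le (Ordinal.le_iSup (fun j => (y j : Ordinal)) _)
  have hδcof : δ.cof ≤ μ := by
    rw [hδ, Ordinal.cof_iSup_Iio (fun _ _ h => hmono h) hlim.isSuccPrelimit, hμ.cof_ord]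
  obtain ⟨A, hAcof, η, hη, hAη⟩ := hdom δ hδθ hδcof
  -- A member of `A` lies between `y k` and `y (φ k)`, so at closure points `j` of `φ` the supremum
  -- `X j` is a limit of `A`.
  have hφ : ∀ k : Set.Iio μ.ord, ∃ m, ∃ a ∈ A, (y k : Ordinal) < a ∧ a < y m := fun k => by
    obtain ⟨a, ha, hka, haδ⟩ := hAcof _ (hyδ (sc k))
    obtain ⟨m, hm⟩ := Ordinal.lt_iSup_iff.1 haδ
    exact ⟨m, a, ha, (hmono (hsc k)).trans_le hka, hm⟩
  choose φ hφ using hφ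
  obtain ⟨b, hb, hbσ, hCb⟩ := hC (fun k => if h : k < μ.ord then (φ ⟨k, h⟩).1 else 0) (by
    intro k hk
    simp only [hk, dif_pos]
    exact (φ ⟨k, hk⟩).2)
  have hφC : ∀ j ∈ C b, ∀ k : Set.Iio μ.ord, k < j → φ k < j := fun j hj k hk => by
    have := (hCb hj).1 k hk
    simpa [show k.1 < μ.ord from k.2] using this
  have hCμ : ∀ j ∈ C b, j < μ.ord := fun j hj => (hCsub b hj).trans hb
  have hXacc : ∀ j ∈ C b, X j ∈ limitPoints A δ := fun j hj => by
    refine ⟨(hXy ⟨j, hCμ j hj⟩).trans_lt (hyδ _), fun z hz => ?_⟩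
    obtain ⟨_, ⟨k, hk, rfl⟩, hzk⟩ := (lt_csSup_iff' (hbdd j)).1 hz
    obtain ⟨a, ha, hka, ham⟩ := hφ k
    exact ⟨a, ha, hzk.trans hka, ham.trans_le (hyX (hφC j hj k hk))⟩
  have hlimC : ∀ j ∈ C b, ∀ k : Set.Iio μ.ord, k < j → k.1 + 1 < j := fun j hj k hk => by
    obtain ⟨a, ha, hka, ham⟩ := hφ k
    exact (Order.add_one_le_of_lt (show k.1 < (φ k).1 from hmono' (hka.trans ham))).trans_lt (hφC j hj k hk)
  have hq : ∀ j : C b, ∃ q : I → Ordinal.{u}, ∀ᶠ i in F, q i ∈ S i ∧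
      (∀ k ∈ C b, k ≤ j → f (X k) i ≤ q i) ∧ q i < f (y ⟨j, hCμ j j.2⟩) i := fun j => by
    obtain ⟨q, hq⟩ := (hy ⟨j, hCμ j j.2⟩).2 b hb ⟨η, hη, by
      filter_upwards [hAη] with i hi k hk hkj
      rw [hXeq _ k hkj]
      exact hi _ (hXacc k hk)⟩
    refine ⟨q, ?_⟩
    filter_upwards [hq] with i hi
    exact ⟨hi.1, fun k hk hkj => hXeq ⟨j, hCμ j j.2⟩ k hkj ▸ hi.2.1 k hk hkj, hi.2.2⟩
  choose q hq using hq
  have hnext : ∀ j : C b, ∀ᶠ i in F, ∀ k ∈ C b, j.1 < k → (∀ l ∈ C b, j.1 < l → k ≤ l) →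
      f (y ⟨j, hCμ j j.2⟩) i < f (X k) i := fun j => by
    by_cases h : ∃ k ∈ C b, j.1 < k
    · have hmem : sInf {k | k ∈ C b ∧ j.1 < k} ∈ {k | k ∈ C b ∧ j.1 < k} := csInf_mem h
      set n := sInf {k | k ∈ C b ∧ j.1 < k}
      have hlt : (y ⟨j, hCμ j j.2⟩ : Ordinal) < X n :=
        (hmono (hsc _)).trans_le (hyX (hlimC n hmem.1 ⟨j, hCμ j j.2⟩ hmem.2))
      filter_upwards [hinc _ _ hlt ((hXy ⟨n, hCμ n hmem.1⟩).trans_lt (y _).2)]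
        with i hi k hk hjk hmin
      have : k = n := le_antisymm (hmin n hmem.1 hmem.2) (csInf_le' ⟨hk, hjk⟩)
      rwa [this]
    · exact Filter.Eventually.of_forall fun i k hk hjk => absurd ⟨k, hk, hjk⟩ h
  -- Pigeonhole: choose for each `j ∈ C b` one good coordinate. Where coordinates agree, the
  -- witnesses strictly increase, so `j ↦ (i j, q j (i j))` embeds at least τ⁺ points into the
  -- disjoint union of the `S i`, which has size at most τ.
  choose i hi using fun j => ((hq j).and (hnext j)).exists
  have hlt : ∀ j k, j < k → i j = i k → q j (i j) < q k (i k) := fun j k hjk hik => by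
    have hmem : sInf {k | k ∈ C b ∧ j.1 < k} ∈ {k | k ∈ C b ∧ j.1 < k} := csInf_mem ⟨k, k.2, hjk⟩
    have hmin : ∀ l ∈ C b, j.1 < l → sInf {k | k ∈ C b ∧ j.1 < k} ≤ l :=
      fun l hl hjl => csInf_le' ⟨hl, hjl⟩
    calc q j (i j) < f (y ⟨j, hCμ j j.2⟩) (i j) := (hi j).1.2.2
      _ ≤ f (X (sInf {k | k ∈ C b ∧ j.1 < k})) (i j) := ((hi j).2 _ hmem.1 hmem.2 hmin).le
      _ ≤ q k (i k) := by
        rw [hik]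
        exact (hi k).1.2.1 _ hmem.1 (hmin k k.2 hjk)
  have hinj : Function.Injective fun j => (⟨i j, q j (i j), (hi j).1.1⟩ : Σ i, S i) := by
    intro j k hjk
    have h1 : i j = i k := congrArg Sigma.fst hjk
    have h2 : q j (i j) = q k (i k) := congrArg (fun z : Σ i, S i => (z.2 : Ordinal)) hjk
    rcases lt_trichotomy j k with h | h | h
    · exact absurd h2 (hlt j k h h1).ne
    · exact h
    · exact absurd h2.symm (hlt k j h h1.symm).ne
  have hcard : #(Σ i, S i) ≤ Cardinal.lift.{u + 1} τ := by
    rw [mk_sigma]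
    refine (sum_le_sum _ _ hS).trans ?_
    rw [sum_const']
    exact (mul_le_mul' hI le_rfl).trans (mul_eq_self (aleph0_le_lift.2 hτ)).le
  exact absurd (lift_le.1 ((hbσ.trans (mk_le_of_injective hinj)).trans hcard))
    (not_le.2 (Order.lt_succ τ))

theorem sInf_anti_of_mem {S T : Set Ordinal.{u}} {o a : Ordinal.{u}} (h : S ⊆ T) (ha : a ∈ S)
    (hoa : o ≤ a) : sInf {s | s ∈ T ∧ o ≤ s} ≤ sInf {s | s ∈ S ∧ o ≤ s} :=
  le_csInf ⟨a, ha, hoa⟩ fun _ hs => csInf_le' ⟨h hs.1, hs.2⟩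

/-- A bounded increasing sequence of functions that is not interleaved with a product of small
sets has a least upper bound modulo the ultrafilter. -/
theorem exists_lub_of_not_interleaved {I : Type (u + 1)} (F : Ultrafilter I) {κ θ : Cardinal.{u}}
    (hκ : ℵ₀ ≤ κ) (hI : #I ≤ Cardinal.lift.{u + 1} κ) (hθ : θ.IsRegular)
    (hκθ : Order.succ κ < θ) (f : Ordinal.{u} → I → Ordinal.{u})
    (hinc : ∀ ξ η, ξ < η → η < θ.ord → ∀ᶠ i in F, f ξ i < f η i)
    (G : I → Ordinal.{u}) (hG : ∀ ξ < θ.ord, ∀ i, f ξ i < G i)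
    (hS : ∀ S : I → Set Ordinal.{u}, (∀ i, #(S i) ≤ Cardinal.lift.{u + 1} κ) →
      ∃ ξ < θ.ord, ∀ η < θ.ord, ∀ p : I → Ordinal.{u},
        ¬ ∀ᶠ i in F, p i ∈ S i ∧ f ξ i ≤ p i ∧ p i < f η i) :
    ∃ g : I → Ordinal.{u}, (∀ ξ < θ.ord, ∀ᶠ i in F, f ξ i ≤ g i) ∧
      ∀ h : I → Ordinal.{u}, (∀ ξ < θ.ord, ∀ᶠ i in F, f ξ i ≤ h i) → ∀ᶠ i in F, g i ≤ h i := by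
  by_contra! hcon
  have hsucc := isRegular_succ hκ
  have hle : ∀ ξ η, ξ ≤ η → η < θ.ord → ∀ᶠ i in F, f ξ i ≤ f η i := fun ξ η h hη =>
    h.eq_or_lt.elim (fun e => e ▸ Filter.Eventually.of_forall fun _ => le_rfl)
      fun h => (hinc ξ η h hη).mono fun _ => le_of_lt
  -- Descend through upper bounds: project `f ξ₀` up to the values used so far. Non-interleaving
  -- makes the projection an upper bound, and the next function is taken strictly below it.
  obtain ⟨y, hy⟩ := exists_forall_of_forall_exists (ι := Set.Iio (Order.succ κ).ord)
    (X := {h : I → Ordinal.{u} // ∀ ξ < θ.ord, ∀ᶠ i in F, f ξ i ≤ h i})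
    (fun j prev x => ∃ ξ₀ < θ.ord, ∀ ξ < θ.ord, ξ₀ ≤ ξ → ∀ᶠ i in F,
      x.1 i < sInf {s | s ∈ insert (G i) (Set.range fun k => (prev k).1 i) ∧ f ξ i ≤ s}) (by
    intro j prev
    set S : I → Set Ordinal.{u} := fun i => insert (G i) (Set.range fun k => (prev k).1 i)
    obtain ⟨ξ₀, hξ₀, hno⟩ := hS S fun i => by
      refine mk_insert_le.trans ?_
      have h1 : #(Set.range fun k => (prev k).1 i) ≤ Cardinal.lift.{u + 1} κ := by
        refine mk_range_le.trans ((Order.lt_succ_iff).1 ?_)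
        rw [← lift_succ]
        exact mk_Iio_coe_lt_lift j j.2
      exact (add_le_add h1 (one_le_aleph0.trans (aleph0_le_lift.2 hκ))).trans
        (add_eq_self (aleph0_le_lift.2 hκ)).le
    have hmem : ∀ ξ < θ.ord, ∀ i, sInf {s | s ∈ S i ∧ f ξ i ≤ s} ∈ {s | s ∈ S i ∧ f ξ i ≤ s} :=
      fun ξ hξ i => csInf_mem ⟨G i, Set.mem_insert _ _, (hG ξ hξ i).le⟩
    have hub : ∀ η < θ.ord, ∀ᶠ i in F, f η i ≤ sInf {s | s ∈ S i ∧ f ξ₀ i ≤ s} := fun η hη => by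
      have := hno η hη fun i => sInf {s | s ∈ S i ∧ f ξ₀ i ≤ s}
      rw [← Ultrafilter.eventually_not] at this
      filter_upwards [this] with i hi
      by_contra! hlt
      exact hi ⟨(hmem ξ₀ hξ₀ i).1, (hmem ξ₀ hξ₀ i).2, hlt⟩
    obtain ⟨h, hh, hlt⟩ := hcon _ hub
    refine ⟨⟨h, hh⟩, ξ₀, hξ₀, fun ξ hξ hle' => ?_⟩
    filter_upwards [hlt, hle ξ₀ ξ hle' hξ] with i h1 h2
    refine h1.trans_le (le_csInf ⟨_, hmem ξ hξ i⟩ fun s hs => ?_)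
    exact csInf_le' ⟨hs.1, h2.trans hs.2⟩)
  choose e heθ he using hy
  obtain ⟨b, hb, hbe⟩ := exists_lt_ord_of_isRegular hθ (ι := Set.Iio (Order.succ κ).ord) (by
    rw [lift_id'.{u, u + 1}]
    exact mk_Iio_lt_lift (ord_lt_ord.2 hκθ)) e heθ
  set S : Set.Iio (Order.succ κ).ord → I → Set Ordinal.{u} :=
    fun j i => insert (G i) (Set.range fun k : Set.Iio j => (y k).1 i)
  have hSmono : ∀ {j k}, j ≤ k → ∀ i, S j i ⊆ S k i := fun {j k} hjk i =>
    Set.insert_subset_insert (by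
      rintro _ ⟨l, rfl⟩
      exact ⟨⟨l, lt_of_lt_of_le l.2 hjk⟩, rfl⟩)
  -- The projections of the single function `f b` decrease in κ⁺ stages on at most κ coordinates, so
  -- they stabilize, although adding `y j` must lower them somewhere.
  obtain ⟨j, hj⟩ := exists_forall_ge_eq_of_antitone (ι := Set.Iio (Order.succ κ).ord) (X := I)
    (by
      rw [Ordinal.cof_Iio, ← Ordinal.lift_cof, hsucc.cof_ord, lift_lt]
      refine hI.trans_lt (lift_lt.2 (Order.lt_succ κ)))
    (fun j i => sInf {s | s ∈ S j i ∧ f b i ≤ s})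
    (fun j k hjk i => sInf_anti_of_mem (hSmono hjk i) (Set.mem_insert _ _) (hG b hb i).le)
  have hlimsucc := isSuccLimit_ord hsucc.aleph0_le
  let j' : Set.Iio (Order.succ κ).ord := ⟨j.1 + 1, hlimsucc.add_one_lt j.2⟩
  have hjj' : j < j' := lt_add_one j.1
  obtain ⟨i, hi₁, hi₂⟩ := ((he j b hb (hbe j).le).and ((y j).2 b hb)).exists
  have h1 : sInf {s | s ∈ S j' i ∧ f b i ≤ s} = sInf {s | s ∈ S j i ∧ f b i ≤ s} :=
    congrFun (hj j' hjj'.le) i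
  have h2 : sInf {s | s ∈ S j' i ∧ f b i ≤ s} ≤ (y j).1 i :=
    csInf_le' ⟨Set.mem_insert_of_mem _ ⟨⟨j, hjj'⟩, rfl⟩, hi₂⟩
  exact absurd hi₁ (not_lt.2 (h1 ▸ h2))

/-- A least upper bound of a sequence that is not interleaved with products of sets of size `τ`
has cofinalities above `τ` almost everywhere. -/
theorem eventually_lt_cof_of_not_interleaved {I : Type (u + 1)} (F : Ultrafilter I)
    {τ θ : Cardinal.{u}} (hθ : θ.IsRegular) (f : Ordinal.{u} → I → Ordinal.{u})
    (hinc : ∀ ξ η, ξ < η → η < θ.ord → ∀ᶠ i in F, f ξ i < f η i)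
    (hS : ∀ S : I → Set Ordinal.{u}, (∀ i, #(S i) ≤ Cardinal.lift.{u + 1} τ) →
      ∃ ξ < θ.ord, ∀ η < θ.ord, ∀ p : I → Ordinal.{u},
        ¬ ∀ᶠ i in F, p i ∈ S i ∧ f ξ i ≤ p i ∧ p i < f η i)
    (g : I → Ordinal.{u}) (hg : ∀ ξ < θ.ord, ∀ᶠ i in F, f ξ i ≤ g i)
    (hlub : ∀ h : I → Ordinal.{u}, (∀ ξ < θ.ord, ∀ᶠ i in F, f ξ i ≤ h i) → ∀ᶠ i in F, g i ≤ h i) :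
    ∀ᶠ i in F, τ < (g i).cof := by
  by_contra hcon
  rw [← Ultrafilter.eventually_not] at hcon
  choose A hAsub hAcof hAcard using exists_cofinal_subset.{u}
  -- Small cofinal subsets of the `g i` would interleave: a selection `p` from them lies below `g`,
  -- so it is no upper bound and some `f η` passes it.
  obtain ⟨ξ, hξ, hno⟩ := hS (fun i => {s | s ∈ A (g i) ∧ (g i).cof ≤ τ}) fun i => by
    by_cases h : (g i).cof ≤ τ
    · refine (mk_le_mk_of_subset fun s hs => hs.1).trans ?_
      rw [hAcard, Cardinal.lift_le]
      exact h
    · simp [h]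
  have hξ1 : ξ + 1 < θ.ord := (isSuccLimit_ord hθ.aleph0_le).add_one_lt hξ
  have hex : ∀ i, ∃ p, f ξ i < g i → p ∈ A (g i) ∧ f ξ i ≤ p := fun i => by
    by_cases h : f ξ i < g i
    · obtain ⟨p, hp⟩ := hAcof _ _ h
      exact ⟨p, fun _ => hp⟩
    · exact ⟨0, fun h' => absurd h' h⟩
  choose p hp using hex
  have hfg : ∀ᶠ i in F, f ξ i < g i := by
    filter_upwards [hg _ hξ1, hinc _ _ (lt_add_one ξ) hξ1] with i h1 h2
    exact h2.trans_le h1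
  have hpg : ¬ ∀ᶠ i in F, g i ≤ p i := fun h => by
    obtain ⟨i, h1, h2⟩ := (h.and hfg).exists
    exact absurd (hAsub _ (hp i h2).1) (not_lt.2 h1)
  have := mt (hlub p) hpg
  push Not at this
  obtain ⟨η, hη, h⟩ := this
  apply hno η hη p
  filter_upwards [h, hcon, hfg] with i h1 h2 h3
  exact ⟨⟨(hp i h3).1, not_lt.1 h2⟩, (hp i h3).2, h1⟩

/-- Sending a limit point to the least member of `A` above it is strictly increasing, since a member
of `A` separates any two limit points. -/
theorem mk_limitPoints_le {A : Set Ordinal.{u}} {δ : Ordinal.{u}}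
    (hA : ∀ z < δ, ∃ x ∈ A, z ≤ x) : #(limitPoints A δ) ≤ #A := by
  have hmem : ∀ x : limitPoints A δ, sInf {a | a ∈ A ∧ x ≤ a} ∈ {a | a ∈ A ∧ x ≤ a} := fun x =>
    csInf_mem (hA x x.2.1)
  have hlt : ∀ x y : limitPoints A δ, x < y →
      sInf {a | a ∈ A ∧ x ≤ a} < sInf {a | a ∈ A ∧ y ≤ a} := fun x y hxy => by
    obtain ⟨a, ha, hxa, hay⟩ := y.2.2 x hxy
    exact (csInf_le' (s := {a | a ∈ A ∧ x ≤ a}) ⟨ha, hxa.le⟩).trans_lt (hay.trans_le (hmem y).2)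
  refine mk_le_of_injective (f := fun x => (⟨sInf {a | a ∈ A ∧ x ≤ a}, (hmem x).1⟩ : A)) ?_
  have : StrictMono fun x : limitPoints A δ => (⟨sInf {a | a ∈ A ∧ x ≤ a}, (hmem x).1⟩ : A) :=
    fun x y hxy => hlt x y hxy
  exact this.injective

theorem exists_monotone_cofinal {o : Ordinal.{u}} (ho : ℵ₀ ≤ o.cof) :
    ∃ c : Ordinal.{u} → Ordinal.{u}, Monotone c ∧ (∀ m < o.cof.ord, c m < o) ∧
      ∀ z < o, ∃ m < o.cof.ord, z ≤ c m := by
  obtain ⟨A, hA, hAcof, hAcard⟩ := exists_cofinal_subset o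
  have : #(Set.Iio o.cof.ord) = #A := by rw [hAcard, mk_Iio_ordinal, card_ord]
  obtain ⟨e⟩ := Cardinal.eq.1 this
  refine ⟨fun m => ⨆ k : {k : Set.Iio o.cof.ord // k.1 < m}, (e k : Ordinal) + 1,
    fun m n hmn => ?_, fun m hm => ?_, fun z hz => ?_⟩
  · exact Ordinal.iSup_le fun k =>
      Ordinal.le_iSup (fun k : {k : Set.Iio o.cof.ord // k.1 < n} => (e k : Ordinal) + 1)
        ⟨k.1, k.2.trans_le hmn⟩
  · refine Ordinal.lift_iSup_add_one_lt_of_lt_cof ?_ fun k => hA (e k).2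
    rw [← Ordinal.lift_cof, lift_id'.{u, u + 1}]
    exact mk_Iio_coe_lt_lift ⟨m, hm⟩ hm
  · obtain ⟨x, hx, hzx⟩ := hAcof z hz
    obtain ⟨k, hk⟩ := e.surjective ⟨x, hx⟩
    refine ⟨k.1 + 1, (isSuccLimit_ord ho).add_one_lt k.2, ?_⟩
    have h1 : x < (fun m => ⨆ k : {k : Set.Iio o.cof.ord // k.1 < m}, (e k : Ordinal) + 1)
        (k.1 + 1) := by
      have := Ordinal.lt_iSup_add_one
        (fun k' : {k' : Set.Iio o.cof.ord // k'.1 < k.1 + 1} => (e k' : Ordinal))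
        ⟨k, lt_add_one k.1⟩
      simpa [hk] using this
    exact hzx.trans h1.le

/-! ### Cofinalities of ultraproducts -/

section Ultraproduct

variable {a : Set Cardinal.{u}} {F : Ultrafilter a}

/-- The class of a function in the ultraproduct. -/
def ultraproductMk (x : (μ : a) → Set.Iio (μ : Cardinal.{u}).ord) : CardinalUltraproduct a F :=
  Quotient.mk'' x

theorem ultraproductMk_le {x y : (μ : a) → Set.Iio (μ : Cardinal.{u}).ord} :
    ultraproductMk (F := F) x ≤ ultraproductMk y ↔ ∀ᶠ i in F, x i ≤ y i := Iff.rfl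

theorem ultraproductMk_surjective : Function.Surjective (ultraproductMk (F := F)) :=
  Quotient.mk''_surjective

/-- An ultraproduct of linear orders is linear, so a family that is not cofinal has a strict upper
bound. -/
theorem exists_forall_lt_of_lt_cof {ι : Type (u + 1)}
    (h : #ι < Order.cof (CardinalUltraproduct a F))
    (x : ι → (μ : a) → Set.Iio (μ : Cardinal.{u}).ord) :
    ∃ y : (μ : a) → Set.Iio (μ : Cardinal.{u}).ord, ∀ j, ∀ᶠ i in F, x j i < y i := by
  have hnc : ¬ IsCofinal (Set.range fun j => ultraproductMk (F := F) (x j)) :=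
    fun hc => absurd ((Order.cof_le hc).trans mk_range_le) (not_le.2 h)
  simp only [IsCofinal, not_forall] at hnc
  obtain ⟨y, hy⟩ := hnc
  obtain ⟨y, rfl⟩ := ultraproductMk_surjective y
  refine ⟨y, fun j => ?_⟩
  have h1 : ¬ ∀ᶠ i in F, y i ≤ x j i := fun h' => hy ⟨_, ⟨j, rfl⟩, ultraproductMk_le.2 h'⟩
  rw [← Ultrafilter.eventually_not] at h1
  exact h1.mono fun _ => not_le.1

theorem cof_ultraproduct_le {ι : Type (u + 1)}
    (x : ι → (μ : a) → Set.Iio (μ : Cardinal.{u}).ord)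
    (h : ∀ y : (μ : a) → Set.Iio (μ : Cardinal.{u}).ord, ∃ j, ∀ᶠ i in F, y i ≤ x j i) :
    Order.cof (CardinalUltraproduct a F) ≤ #ι := by
  have hc : IsCofinal (Set.range fun j => ultraproductMk (F := F) (x j)) := by
    intro y
    obtain ⟨y, rfl⟩ := ultraproductMk_surjective y
    obtain ⟨j, hj⟩ := h y
    exact ⟨_, ⟨j, rfl⟩, ultraproductMk_le.2 hj⟩
  exact (Order.cof_le hc).trans mk_range_le

theorem exists_cofinal_ultraproduct (a : Set Cardinal.{u}) (F : Ultrafilter a) :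
    ∃ (ι : Type (u + 1)) (x : ι → (μ : a) → Set.Iio (μ : Cardinal.{u}).ord),
      #ι = Order.cof (CardinalUltraproduct a F) ∧
      ∀ y : (μ : a) → Set.Iio (μ : Cardinal.{u}).ord, ∃ j, ∀ᶠ i in F, y i ≤ x j i := by
  obtain ⟨s, hs, hcard⟩ := Order.exists_cof_eq (CardinalUltraproduct a F)
  choose x hx using ultraproductMk_surjective (F := F)
  refine ⟨s, fun t => x t, hcard, fun y => ?_⟩
  obtain ⟨t, ht, hyt⟩ := hs (ultraproductMk y)
  refine ⟨⟨t, ht⟩, ?_⟩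
  rw [← hx t] at hyt
  exact ultraproductMk_le.1 hyt

variable {κ lam : Cardinal.{u}}

theorem eventually_lt_of_not_boundedBelow (hF : ∀ b : Set a, BoundedBelow lam b → b ∉ F)
    {c : Cardinal.{u}} (hc : c < lam) : ∀ᶠ μ : a in F, c < (μ : Cardinal.{u}) := by
  have h : {μ : a | (μ : Cardinal.{u}) ≤ c} ∉ F := hF _ ⟨c, hc, fun _ h => h⟩
  have := Ultrafilter.compl_mem_iff_notMem.2 h
  exact Filter.mem_of_superset this fun μ hμ => not_le.1 (show ¬ (μ : Cardinal.{u}) ≤ c from hμ)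

/-- Almost every factor is a regular cardinal above `c`, where suprema of `c` values can be taken
pointwise; one set in `F` serves all indices `j`. -/
theorem exists_forall_le_of_lt (ha : ∀ μ ∈ a, μ.IsRegular)
    (hF : ∀ b : Set a, BoundedBelow lam b → b ∉ F) {ι : Type (u + 1)} {c : Cardinal.{u}}
    (hc : c < lam) (hι : #ι ≤ Cardinal.lift.{u + 1} c)
    (x : ι → (μ : a) → Set.Iio (μ : Cardinal.{u}).ord) :
    ∃ y : (μ : a) → Set.Iio (μ : Cardinal.{u}).ord, ∀ᶠ i in F, ∀ j, x j i < y i := by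
  have hex : ∀ μ : a, ∃ b : Set.Iio (μ : Cardinal.{u}).ord, c < (μ : Cardinal.{u}) →
      ∀ j, x j μ < b := fun μ => by
    by_cases h : c < (μ : Cardinal.{u})
    · obtain ⟨b, hb, hbx⟩ := exists_lt_ord_of_isRegular (ha μ μ.2) (ι := ι) (by
        rw [lift_id'.{u, u + 1}]
        exact hι.trans_lt (lift_lt.2 h)) (fun j => (x j μ : Ordinal)) fun j => (x j μ).2
      exact ⟨⟨b, hb⟩, fun _ => hbx⟩
    · exact ⟨⟨0, (ha μ μ.2).ord_pos⟩, fun h' => absurd h' h⟩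
  choose y hy using hex
  exact ⟨y, (eventually_lt_of_not_boundedBelow hF hc).mono fun i hi => hy i hi⟩

theorem lift_le_cof_ultraproduct (ha : ∀ μ ∈ a, μ.IsRegular)
    (hF : ∀ b : Set a, BoundedBelow lam b → b ∉ F) :
    Cardinal.lift.{u + 1} lam ≤ Order.cof (CardinalUltraproduct a F) := by
  obtain ⟨ι, x, hι, hx⟩ := exists_cofinal_ultraproduct a F
  by_contra! hlt
  obtain ⟨c, hc⟩ := mem_range_lift_of_le hlt.le
  rw [← hc, lift_lt] at hlt
  obtain ⟨y, hy⟩ := exists_forall_le_of_lt ha hF hlt (hι.trans hc.symm).le x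
  obtain ⟨j, hj⟩ := hx y
  obtain ⟨i, h1, h2⟩ := (hy.and hj).exists
  exact absurd (h1 j) (not_lt.2 h2)

/-- Were ν singular, a cofinal family of size ν could be cut into `cof ν` initial segments of
smaller size; bounds for these would form a cofinal family that is too small. -/
theorem isRegular_of_cof_ultraproduct {ν : Cardinal.{u}} (hν : ℵ₀ ≤ ν)
    (h : Order.cof (CardinalUltraproduct a F) = Cardinal.lift.{u + 1} ν) : ν.IsRegular := by
  refine ⟨hν, ?_⟩
  by_contra! hlt
  obtain ⟨ι, x, hι, hx⟩ := exists_cofinal_ultraproduct a F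
  have : #(Set.Iio ν.ord) = #ι := by rw [hι, h, mk_Iio_ordinal, card_ord]
  obtain ⟨e⟩ := Cardinal.eq.1 this
  obtain ⟨A, hA, hAcof, hAcard⟩ := exists_cofinal_subset ν.ord
  have hex : ∀ b : A, ∃ y : (μ : a) → Set.Iio (μ : Cardinal.{u}).ord,
      ∀ k : Set.Iic (⟨b, hA b.2⟩ : Set.Iio ν.ord), ∀ᶠ i in F, x (e k) i < y i := fun b => by
    refine exists_forall_lt_of_lt_cof (ι := Set.Iic (⟨b, hA b.2⟩ : Set.Iio ν.ord)) ?_ _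
    rw [h]
    have hb : (b : Ordinal) + 1 < ν.ord := (isSuccLimit_ord hν).add_one_lt (hA b.2)
    refine (mk_le_of_injective (f := fun k : Set.Iic (⟨b, hA b.2⟩ : Set.Iio ν.ord) =>
      (⟨k.1.1, Order.lt_add_one_iff.2 (show k.1.1 ≤ b.1 from k.2)⟩ : Set.Iio (b.1 + 1))) fun x y hxy => ?_).trans_lt
      (mk_Iio_lt_lift hb)
    exact Subtype.ext (Subtype.ext (by simpa [Subtype.ext_iff] using hxy))
  choose y hy using hex
  have := cof_ultraproduct_le (F := F) y fun z => by
    obtain ⟨j, hj⟩ := hx z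
    obtain ⟨k, rfl⟩ := e.surjective j
    obtain ⟨b, hb, hkb⟩ := hAcof k k.2
    refine ⟨⟨b, hb⟩, ?_⟩
    filter_upwards [hj, hy ⟨b, hb⟩ ⟨k, hkb⟩] with i h1 h2
    exact h1.trans h2.le
  rw [h, hAcard, lift_le] at this
  exact absurd this (not_le.2 hlt)

/-- Below the cofinality of the ultraproduct there are increasing sequences that dominate their
suprema over clubs at points of cofinality below `lam`. -/
theorem exists_continuous_increasing_sequence (ha : ∀ μ ∈ a, μ.IsRegular)
    (hF : ∀ b : Set a, BoundedBelow lam b → b ∉ F) {θ : Cardinal.{u}} (hθ : ℵ₀ ≤ θ)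
    (h : Cardinal.lift.{u + 1} θ < Order.cof (CardinalUltraproduct a F)) :
    ∃ f : Ordinal.{u} → a → Ordinal.{u}, (∀ ξ < θ.ord, ∀ i : a, f ξ i < (i : Cardinal.{u}).ord) ∧
      (∀ ξ η, ξ < η → η < θ.ord → ∀ᶠ i in F, f ξ i < f η i) ∧
      ∀ δ < θ.ord, δ.cof < lam → ∃ A, (∀ z < δ, ∃ b ∈ A, z ≤ b ∧ b < δ) ∧
        ∃ η < θ.ord, ∀ᶠ i in F, ∀ x ∈ limitPoints A δ, f x i ≤ f η i := by
  choose A hAsub hAcof hAcard using exists_cofinal_subset.{u}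
  obtain ⟨y, hy⟩ := exists_forall_of_forall_exists (ι := Set.Iio θ.ord)
    (X := (μ : a) → Set.Iio (μ : Cardinal.{u}).ord)
    (fun δ prev x => (∀ k, ∀ᶠ i in F, prev k i < x i) ∧ (δ.1.cof < lam → ∀ᶠ i in F,
      ∀ k, k.1.1 ∈ limitPoints (A δ) δ → prev k i ≤ x i)) (by
    intro δ prev
    have hs : ∃ s : (μ : a) → Set.Iio (μ : Cardinal.{u}).ord, δ.1.cof < lam → ∀ᶠ i in F,
        ∀ k, k.1.1 ∈ limitPoints (A δ) δ → prev k i ≤ s i := by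
      by_cases hδ : δ.1.cof < lam
      · obtain ⟨s, hs⟩ := exists_forall_le_of_lt ha hF hδ
          (ι := limitPoints (A δ) δ) (by
            rw [← hAcard]
            exact mk_limitPoints_le (hAcof δ))
          fun k => prev ⟨⟨k.1, lt_trans k.2.1 δ.2⟩, k.2.1⟩
        exact ⟨s, fun _ => hs.mono fun i hi k hk => (hi ⟨k.1.1, hk⟩).le⟩
      · exact ⟨fun μ => ⟨0, (ha μ μ.2).ord_pos⟩, fun h' => absurd h' hδ⟩
    obtain ⟨s, hs⟩ := hs
    obtain ⟨x, hx⟩ := exists_forall_lt_of_lt_cof (F := F) (ι := Option (Set.Iio δ)) (by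
      refine lt_of_le_of_lt ?_ h
      rw [mk_option]
      have h1 := (mk_Iio_coe_lt_lift δ δ.2).le
      exact (add_le_add h1 (one_le_aleph0.trans (aleph0_le_lift.2 hθ))).trans
        (add_eq_self (aleph0_le_lift.2 hθ)).le) fun o => o.elim s prev
    refine ⟨x, fun k => hx (some k), fun hδ => ?_⟩
    filter_upwards [hs hδ, hx none] with i h1 h2 k hk
    exact (h1 k hk).trans h2.le)
  refine ⟨fun ξ i => if hξ : ξ < θ.ord then y ⟨ξ, hξ⟩ i else 0, fun ξ hξ i => ?_,
    fun ξ η hξη hη => ?_, fun δ hδ hcof => ⟨A δ, fun z hz => ?_, δ, hδ, ?_⟩⟩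
  · simp only [hξ, dif_pos]
    exact (y ⟨ξ, hξ⟩ i).2
  · simp only [hη, hξη.trans hη, dif_pos]
    exact (hy ⟨η, hη⟩).1 ⟨⟨ξ, hξη.trans hη⟩, hξη⟩
  · obtain ⟨x, hx, hzx⟩ := hAcof δ z hz
    exact ⟨x, hx, hzx, hAsub δ hx⟩
  · filter_upwards [(hy ⟨δ, hδ⟩).2 hcof] with i hi x hx
    simp only [hδ, hx.1.trans hδ, dif_pos]
    exact hi ⟨⟨x, hx.1.trans hδ⟩, hx.1⟩ hx

/-- The length of a sequence with a least upper bound of large cofinalities is the cofinality of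
an ultraproduct. -/
theorem mem_PP_of_lub (ha : ∀ μ ∈ a, μ.IsRegular ∧ μ < lam)
    (hκ : ℵ₀ ≤ κ) (hκlam : κ < lam) (hacard : #a ≤ Cardinal.lift.{u + 1} κ) {θ : Cardinal.{u}}
    (hθ : θ.IsRegular) (f : Ordinal.{u} → a → Ordinal.{u})
    (hf : ∀ ξ < θ.ord, ∀ i : a, f ξ i < (i : Cardinal.{u}).ord)
    (hinc : ∀ ξ η, ξ < η → η < θ.ord → ∀ᶠ i in F, f ξ i < f η i)
    (g : a → Ordinal.{u}) (hg : ∀ ξ < θ.ord, ∀ᶠ i in F, f ξ i ≤ g i)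
    (hlub : ∀ h : a → Ordinal.{u}, (∀ ξ < θ.ord, ∀ᶠ i in F, f ξ i ≤ h i) → ∀ᶠ i in F, g i ≤ h i)
    (hcof : ∀ τ < lam, ∀ᶠ i in F, τ < (g i).cof) : θ ∈ PP κ lam := by
  have hfg : ∀ ξ < θ.ord, ∀ᶠ i in F, f ξ i < g i := fun ξ hξ => by
    have hξ1 : ξ + 1 < θ.ord := (isSuccLimit_ord hθ.aleph0_le).add_one_lt hξ
    filter_upwards [hg _ hξ1, hinc _ _ (lt_add_one ξ) hξ1] with i h1 h2
    exact h2.trans_le h1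
  have hlt : ∀ H : a → Ordinal.{u}, (∀ᶠ i in F, H i < g i) → ∃ ξ < θ.ord, ∀ᶠ i in F, H i < f ξ i :=
    fun H hH => by
      by_contra! hcon
      obtain ⟨i, h1, h2⟩ := ((hlub H hcon).and hH).exists
      exact absurd h2 (not_lt.2 h1)
  set B : Set a := {i | κ < (g i).cof ∧ g i ≤ (i : Cardinal.{u}).ord} with hB
  have hBF : ∀ᶠ i in F, i ∈ B := (hcof κ hκlam).and
    (hlub (fun i => (i : Cardinal.{u}).ord) fun ξ hξ =>
      Filter.Eventually.of_forall fun i => (hf ξ hξ i).le)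
  obtain ⟨i₀, hi₀⟩ := hBF.exists
  set a' : Set Cardinal.{u} := (fun i => (g i).cof) '' B
  have ha' : ∀ μ ∈ a', (μ.IsRegular ∧ μ < lam) ∧ κ < μ := by
    rintro _ ⟨i, hi, rfl⟩
    refine ⟨⟨isRegular_cof (Ordinal.one_lt_cof_iff.1 ?_), ?_⟩, hi.1⟩
    · exact (one_lt_aleph0.trans_le hκ).trans hi.1
    · exact ((Ordinal.cof_le_card _).trans (by simpa using Ordinal.card_le_card hi.2)).trans_lt
        (ha i i.2).2
  classical
  -- Off `B` the value is an arbitrary member of `a'`; `B ∈ F`, so it has no effect.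
  let h : a → a' := fun i => if hi : i ∈ B then ⟨(g i).cof, i, hi, rfl⟩ else ⟨_, i₀, hi₀, rfl⟩
  have hh : ∀ i ∈ B, (h i : Cardinal.{u}) = (g i).cof := fun i hi => by simp only [h, hi, dif_pos]
  have hc : ∀ i : a, ∃ c : Ordinal.{u} → Ordinal.{u}, i ∈ B → Monotone c ∧
      (∀ m < (g i).cof.ord, c m < g i) ∧ ∀ z < g i, ∃ m < (g i).cof.ord, z ≤ c m := fun i => by
    by_cases hi : i ∈ B
    · obtain ⟨c, hc⟩ := exists_monotone_cofinal (hκ.trans hi.1.le)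
      exact ⟨c, fun _ => hc⟩
    · exact ⟨id, fun h' => absurd h' hi⟩
  choose c hc using hc
  have hcg : ∀ p : (μ : a') → Set.Iio (μ : Cardinal.{u}).ord, ∀ᶠ i in F, c i (p (h i)) < g i :=
    fun p => hBF.mono fun i hi => (hc i hi).2.1 _ (by
      rw [← hh i hi]
      exact (p (h i)).2)
  have hproj : ∀ H : a → Ordinal.{u}, (∀ᶠ i in F, H i < g i) →
      ∃ p : (μ : a') → Set.Iio (μ : Cardinal.{u}).ord, ∀ᶠ i in F, H i ≤ c i (p (h i)) := by
    intro H hH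
    have hq : ∀ i : a, ∃ m, i ∈ B → m < (g i).cof.ord ∧ (H i < g i → H i ≤ c i m) := fun i => by
      by_cases hi : i ∈ B ∧ H i < g i
      · obtain ⟨m, hm⟩ := (hc i hi.1).2.2 _ hi.2
        exact ⟨m, fun _ => ⟨hm.1, fun _ => hm.2⟩⟩
      · refine ⟨0, fun hi' => ⟨?_, fun h' => absurd ⟨hi', h'⟩ hi⟩⟩
        rw [← hh i hi']
        exact (ha' _ (h i).2).1.1.ord_pos
    choose q hq using hq
    -- Fibres of `h` have at most κ points and every member of `a'` is regular above κ, so a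
    -- supremum over each fibre gives a bound depending only on `h i`.
    have hex : ∀ μ : a', ∃ b : Set.Iio (μ : Cardinal.{u}).ord, ∀ i ∈ B, h i = μ → q i < b := by
      intro μ
      obtain ⟨b, hb, hbq⟩ := exists_lt_ord_of_isRegular (ha' μ μ.2).1.1
        (ι := {i // i ∈ B ∧ h i = μ}) (by
          rw [lift_id'.{u, u + 1}]
          exact ((mk_subtype_le _).trans hacard).trans_lt (lift_lt.2 (ha' μ μ.2).2))
        (fun i => q i) (fun i => by
          have := (hq i i.2.1).1
          rwa [← hh i i.2.1, i.2.2] at this)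
      exact ⟨⟨b, hb⟩, fun i hi hiμ => hbq ⟨i, hi, hiμ⟩⟩
    choose p hp using hex
    refine ⟨p, ?_⟩
    filter_upwards [hBF, hH] with i hi hHi
    exact ((hq i hi).2 hHi).trans ((hc i hi).1 (hp (h i) i hi rfl).le)
  have : Nonempty ((μ : a') → Set.Iio (μ : Cardinal.{u}).ord) :=
    ⟨fun μ => ⟨0, (ha' μ μ.2).1.1.ord_pos⟩⟩
  choose! p hp using fun ξ hξ => hproj (f ξ) (hfg ξ hξ)
  refine ⟨a', fun μ hμ => (ha' μ hμ).1, ?_, F.map h, ?_, le_antisymm ?_ ?_⟩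
  · exact mk_image_le.trans ((mk_subtype_le _).trans hacard)
  · rintro b ⟨t, ht, hbt⟩ hb
    have hb' : ∀ᶠ i in F, h i ∈ b := hb
    obtain ⟨i, h1, hi, h2⟩ := (hb'.and (hBF.and (hcof t ht))).exists
    rw [← hh i hi] at h2
    exact absurd (hbt _ h1) (not_le.2 h2)
  · have := cof_ultraproduct_le (F := F.map h) (ι := Set.Iio θ.ord) (fun ξ => p ξ) fun z => by
      obtain ⟨ξ, hξ, hzξ⟩ := hlt _ (hcg z)
      refine ⟨⟨ξ, hξ⟩, ?_⟩
      change ∀ᶠ i in F, z (h i) ≤ p ξ (h i)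
      filter_upwards [hBF, hzξ, hp ξ hξ] with i hi h1 h2
      by_contra! hcon
      exact absurd ((hc i hi).1 hcon.le) (not_le.2 (h1.trans_le h2))
    rwa [mk_Iio_ordinal, card_ord] at this
  · obtain ⟨ι, x, hι, hx⟩ := exists_cofinal_ultraproduct a' (F.map h)
    by_contra! hcon
    rw [← hι] at hcon
    choose e heθ he using fun j => hlt _ (hcg (x j))
    obtain ⟨b, hb, hbe⟩ := exists_lt_ord_of_isRegular hθ (ι := ι) (by rwa [lift_id'.{u, u + 1}])
      e heθ
    obtain ⟨j, hj⟩ := hx (p b)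
    change ∀ᶠ i in F, p b (h i) ≤ x j (h i) at hj
    obtain ⟨i, hi, h1, h2, h3, h4⟩ := (hBF.and (hj.and ((he j).and
      ((hinc _ _ (hbe j) hb).and (hp b hb))))).exists
    exact absurd ((h4.trans ((hc i hi).1 h1)).trans_lt h2) (not_lt.2 h3.le)

theorem exists_cof_ultraproduct_eq_lift (a : Set Cardinal.{u}) [Small.{u} a] (F : Ultrafilter a) :
    ∃ ν : Cardinal.{u}, Order.cof (CardinalUltraproduct a F) = Cardinal.lift.{u + 1} ν := by
  have hs : Small.{u} (CardinalUltraproduct a F) :=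
    small_of_surjective (f := fun x : (μ : a) → Set.Iio (μ : Cardinal.{u}).ord =>
      ultraproductMk (F := F) x) ultraproductMk_surjective
  have : #(CardinalUltraproduct a F) =
      Cardinal.lift.{u + 1} #(Shrink.{u} (CardinalUltraproduct a F)) := by
    have := Cardinal.lift_mk_eq'.2 ⟨equivShrink.{u} (CardinalUltraproduct a F)⟩
    rwa [lift_id'.{u, u + 1}] at this
  obtain ⟨ν, hν⟩ := mem_range_lift_of_le ((Order.cof_le_cardinalMk _).trans this.le)
  exact ⟨ν, hν.symm⟩

end Ultraproduct

/-! ### Nonemptiness, the lower bound and convexity -/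

variable {κ lam : Cardinal.{u}}

/-- Successor cardinals cofinal in λ form a suitable `a`, and an ultrafilter containing its tails
avoids all bounded sets. -/
theorem PP_nonempty (hlam : lam.IsSingular) (hcof : lam.ord.cof ≤ κ) : (PP κ lam).Nonempty := by
  have hlim := hlam.isSuccLimit
  obtain ⟨A, hA, hAcof, hAcard⟩ := exists_cofinal_subset lam.ord
  set a : Set Cardinal.{u} := (fun x => Order.succ (max ℵ₀ x.card)) '' A
  have ha : ∀ μ ∈ a, μ.IsRegular ∧ μ < lam := by
    rintro _ ⟨x, hx, rfl⟩
    refine ⟨isRegular_succ (le_max_left _ _), hlim.succ_lt (max_lt ?_ (lt_ord.1 (hA hx)))⟩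
    exact hlam.aleph0_le.lt_of_ne fun h => not_isSingular_aleph0 (h ▸ hlam)
  have hacard : #a ≤ Cardinal.lift.{u + 1} κ :=
    mk_image_le.trans (hAcard.le.trans (lift_le.2 hcof))
  have hex : ∀ t < lam, ∃ μ : a, t < μ := fun t ht => by
    obtain ⟨x, hx, htx⟩ := hAcof _ (ord_lt_ord.2 ht)
    refine ⟨⟨_, x, hx, rfl⟩, Order.lt_succ_of_le ?_⟩
    exact le_max_of_le_right (ord_le.1 htx)
  have : Nonempty a := ⟨(hex 0 hlam.pos).choose⟩
  have : Small.{u} a := by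
    rw [← mk_out κ] at hacard
    obtain ⟨e⟩ := lift_mk_le'.1 ((lift_id'.{u, u + 1} #a).le.trans hacard)
    exact small_of_injective e.injective
  obtain ⟨ν, hν⟩ := exists_cof_ultraproduct_eq_lift a (Ultrafilter.of Filter.atTop)
  refine ⟨ν, a, ha, hacard, _, ?_, hν⟩
  rintro b ⟨t, ht, hbt⟩ hb
  obtain ⟨μ, hμ⟩ := hex t ht
  have h1 := Ultrafilter.of_le Filter.atTop (Filter.Ici_mem_atTop μ)
  obtain ⟨i, hi, hib⟩ := Ultrafilter.nonempty_of_mem (Filter.inter_mem h1 hb)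
  exact absurd (hμ.trans_le hi) (not_lt.2 (hbt i hib))

theorem lt_and_isRegular_of_mem_PP (hlam : lam.IsSingular) {ν : Cardinal.{u}} (hν : ν ∈ PP κ lam) :
    lam < ν ∧ ν.IsRegular := by
  obtain ⟨a, ha, -, F, hF, hcof⟩ := hν
  have hle := lift_le_cof_ultraproduct (fun μ hμ => (ha μ hμ).1) hF
  rw [hcof, lift_le] at hle
  have hreg := isRegular_of_cof_ultraproduct (hlam.aleph0_le.trans hle) hcof
  exact ⟨hle.lt_of_ne fun h => hlam.not_isRegular (h ▸ hreg), hreg⟩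

theorem mem_PP_of_lt_of_le (hlam : lam.IsSingular) (hκ : ℵ₀ ≤ κ) (hκlam : κ < lam)
    {ν θ : Cardinal.{u}} (hν : ν ∈ PP κ lam) (hθ : θ.IsRegular) (hlamθ : lam < θ) (hθν : θ ≤ ν) :
    θ ∈ PP κ lam := by
  obtain rfl | hθν := hθν.eq_or_lt
  · exact hν
  obtain ⟨a, ha, hacard, F, hF, hcof⟩ := hν
  have hlim := hlam.isSuccLimit
  obtain ⟨f, hf, hinc, hdom⟩ := exists_continuous_increasing_sequence (fun μ hμ => (ha μ hμ).1) hF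
    hθ.aleph0_le (by rwa [hcof, lift_lt])
  have hS : ∀ τ, κ ≤ τ → τ < lam → ∀ S : a → Set Ordinal.{u},
      (∀ i, #(S i) ≤ Cardinal.lift.{u + 1} τ) →
      ∃ ξ < θ.ord, ∀ η < θ.ord, ∀ p : a → Ordinal.{u},
        ¬ ∀ᶠ i in F, p i ∈ S i ∧ f ξ i ≤ p i ∧ p i < f η i := fun τ hκτ hτ S hS => by
    -- A singular cardinal is a limit cardinal, so the three successors consumed by club guessing
    -- stay below λ.
    have hτ3 := hlim.succ_lt (hlim.succ_lt (hlim.succ_lt hτ))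
    exact exists_not_interleaved F (hκ.trans hκτ) (hacard.trans (lift_le.2 hκτ)) hθ
      (hτ3.trans hlamθ) f hinc (fun δ hδ hδτ => hdom δ hδ (hδτ.trans_lt hτ3)) S hS
  obtain ⟨g, hg, hlub⟩ := exists_lub_of_not_interleaved F hκ hacard hθ
    ((hlim.succ_lt hκlam).trans hlamθ) f hinc _ hf (hS κ le_rfl hκlam)
  refine mem_PP_of_lub ha hκ hκlam hacard hθ f hf hinc g hg hlub fun τ hτ => ?_
  have := eventually_lt_cof_of_not_interleaved F hθ f hinc
    (hS (max κ τ) (le_max_left _ _) (max_lt hκlam hτ)) g hg hlub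
  exact this.mono fun i hi => (le_max_right _ _).trans_lt hi

theorem mainTheorem6 (κ lam : Cardinal.{u}) (hlam : ℵ₀ ≤ lam)
    (hcof : lam.ord.cof ≤ κ) (hκ : κ < lam) :
    (∀ ν ∈ PP κ lam, ν.IsRegular) ∧
    IsLeast (PP κ lam) (Order.succ lam) ∧
    (∀ μ ∈ PP κ lam, ∀ ν ∈ PP κ lam, ∀ θ : Cardinal.{u},
      θ.IsRegular → μ ≤ θ → θ ≤ ν → θ ∈ PP κ lam) := by
  have hsing : lam.IsSingular := .of_not_isRegular hlam fun h =>
    absurd (h.cof_ord ▸ hcof) (not_le.2 hκ)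
  have hκ0 : ℵ₀ ≤ κ := by
    refine le_trans ?_ hcof
    rw [Ordinal.aleph0_le_cof_iff, Ordinal.one_lt_cof_iff]
    exact isSuccLimit_ord hlam
  have hmem := fun ν (hν : ν ∈ PP κ lam) => lt_and_isRegular_of_mem_PP hsing hν
  refine ⟨fun ν hν => (hmem ν hν).2, ⟨?_, fun ν hν => Order.succ_le_of_lt (hmem ν hν).1⟩,
    fun μ hμ ν hν θ hθ hμθ hθν =>
      mem_PP_of_lt_of_le hsing hκ0 hκ hν hθ ((hmem μ hμ).1.trans_le hμθ) hθν⟩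
  obtain ⟨ν, hν⟩ := PP_nonempty hsing hcof
  exact mem_PP_of_lt_of_le hsing hκ0 hκ hν (isRegular_succ hlam) (Order.lt_succ lam)
    (Order.succ_le_of_lt (hmem ν hν).1)
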